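/- For a bounded measurable set $\Omega\subset\mathbb{R}^3$ of positive measure (for instance a bounded Lipschitz domain) let $$N_\Omega(f)(x)=\int_\Omega \frac{f(y)}{4\pi|x-y|}\,dy,\qquad x\in\Omega,$$ be the Newtonian potential operator on $L^2(\Omega)$ (real- or complex-valued functions), and let $(\lambda_n(\Omega),e_n)_{n\ge 0}$ be an eigen-system of $N_\Omega$: $(e_n)_{n\ge0}$ is an orthonormal basis of $L^2(\Omega)$ with $N_\Omega(e_n)=\lambda_n(\Omega)\,e_n$, and $\lambda_0(\Omega)\ge\lambda_1(\Omega)\ge\cdots$ are listed with multiplicity. If $|\Omega|\sim a^3$, where $a>0$ is the length scale of $\Omega$ (so that $\operatorname{diam}\Omega\lesssim a$, as for $\Omega=z+a\,\Omega^\star$ with a fixed bounded shape $\Omega^\star$), then for every $n\ge 0$ $$\lambda_n(\Omega)\sim a^2\qquad\text{and}\qquad \Big|\int_\Omega e_n(x)\,dx\Big|\lesssim a^{3/2}.$$ Precisely: 1. For every $c_2>0$ there is $C>0$, depending only on $c_2$, such that for all $a>0$, all bounded measurable $\Omega$ with $|\Omega|\le c_2a^3$, every eigen-system of $N_\Omega$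 and every $n\ge0$: $\lambda_n(\Omega)\le C a^2$ and $\big|\int_\Omega e_n\,dx\big|\le C a^{3/2}$. 2. For every $c_1>0$, $R>0$ and $n\ge 0$ there is $c>0$, depending only on $c_1$, $R$ and $n$, such that for all $a>0$, all bounded measurable $\Omega$ with $|\Omega|\ge c_1a^3$ and $\operatorname{diam}\Omega\le Ra$, and every eigen-system of $N_\Omega$: $\lambda_n(\Omega)\ge c\,a^2$. -/

import Mathlib

open MeasureTheory

noncomputable section

/-- The fundamental solution `1 / (4 π |x - y|)` of `-Δ` in `ℝ³`. Its value on the diagonal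
(a null set) plays no role. -/
def newtonianKernel (x y : EuclideanSpace ℝ (Fin 3)) : ℝ :=
  1 / (4 * Real.pi * ‖x - y‖)

/-- The Newtonian potential `N_Ω(f)(x) = ∫_Ω f(y) / (4 π |x - y|) dy`. -/
def newtonianPotential {𝕜 : Type*} [RCLike 𝕜] (Ω : Set (EuclideanSpace ℝ (Fin 3)))
    (f : EuclideanSpace ℝ (Fin 3) → 𝕜) (x : EuclideanSpace ℝ (Fin 3)) : 𝕜 :=
  ∫ y in Ω, newtonianKernel x y • f y

/-- `(lam n, e n)`, `n ≥ 0`, is an eigen-system of the Newtonian potential operator on `L²(Ω)`: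
`e` is an orthonormal Hilbert basis of `L²(Ω)` made of eigenfunctions, and the corresponding
eigenvalues `lam n`, repeated according to multiplicity, are listed in decreasing order. -/
structure IsNewtonianEigensystem {𝕜 : Type*} [RCLike 𝕜]
    (Ω : Set (EuclideanSpace ℝ (Fin 3))) (lam : ℕ → ℝ)
    (e : HilbertBasis ℕ 𝕜 (Lp 𝕜 2 (volume.restrict Ω))) : Prop where
  antitone : Antitone lam
  eigen : ∀ n : ℕ, ∀ᵐ x ∂(volume.restrict Ω),
    newtonianPotential Ω (fun y => e n y) x = lam n • e n x

end

/-! Upper bounds. The kernel has mass `O(a²)` over `Ω`, uniformly in the base point: polar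
coordinates inside a ball of radius `a`, the bound `1/a` times `|Ω|` outside. Integrating the
absolute value of the eigenvalue equation (a Schur test in `L¹`) bounds each eigenvalue by that
mass. The bound on `∫ e_n` is Cauchy–Schwarz.

Lower bound. By the min-max principle it suffices to test on the span of the indicators of `N = n +
1` pieces of `Ω`, each of diameter at most `δ ∼ a` and measure at least of order `a³`, pairwise at
distance at least `2Nδ`. The kernel is at least `1/(4πδ)` within a piece and at most `1/(2N)` times
that between pieces, so the Gram matrix is diagonally dominant and the Rayleigh quotient is at least
of order `a³/δ ∼ a²` (`le_eigenvalue_of_separated`). The pieces come from a greedy choice in a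
covering by small balls (`exists_separated_balls`); only volume and diameter matter, not the shape.
-/

/-! ### Rayleigh quotients and diagonally dominant forms -/

/-- If `P` is obtained from `F` by applying the diagonal operator with decreasing eigenvalues `lam`
in the Hilbert basis `b`, and `F` is orthogonal to the first `n` basis vectors, then the Rayleigh
quotient of `F` is at most `lam n`. -/
lemma HilbertBasis.re_inner_le_of_orthogonal {𝕜 H : Type*} [RCLike 𝕜] [NormedAddCommGroup H]
    [InnerProductSpace 𝕜 H] (b : HilbertBasis ℕ 𝕜 H) {lam : ℕ → ℝ} (hlam : Antitone lam)
    (n : ℕ) (F P : H) (hP : ∀ k, inner 𝕜 P (b k) = lam k • inner 𝕜 F (b k))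
    (hF : ∀ k < n, inner 𝕜 F (b k) = 0) :
    RCLike.re (inner 𝕜 P F) ≤ lam n * ‖F‖ ^ 2 := by
  have key : ∀ k, RCLike.re (inner 𝕜 F (b k) * inner 𝕜 (b k) F) = ‖inner 𝕜 F (b k)‖ ^ 2 := by
    intro k
    rw [← inner_conj_symm (b k) F, RCLike.mul_conj]
    norm_cast
  have h1 := (RCLike.hasSum_re 𝕜 (b.hasSum_inner_mul_inner F F)).mul_left (lam n)
  have h2 := RCLike.hasSum_re 𝕜 (b.hasSum_inner_mul_inner P F)
  rw [← norm_sq_eq_re_inner] at h1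
  refine hasSum_le (fun k => ?_) h2 h1
  rw [hP k, smul_mul_assoc, RCLike.smul_re, key]
  -- Comparison of the two Parseval series term by term; no sign of `lam` is needed.
  rcases lt_or_ge k n with hk | hk
  · simp [hF k hk]
  · exact mul_le_mul_of_nonneg_right (hlam hk) (by positivity)

/-- A quantitative lower bound for a diagonally dominant quadratic form. -/
lemma re_sum_sum_ge_of_diagonal_dominant {𝕜 ι : Type*} [RCLike 𝕜] [Fintype ι] (c : ι → 𝕜)
    (κ : ι → ι → ℝ) (m : ι → ℝ) (hm : ∀ i, 0 ≤ m i) {β N : ℝ} (hβ : 0 ≤ β) (hN : 0 < N)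
    (hcard : (Fintype.card ι : ℝ) ≤ N) (hdiag : ∀ i, β * (m i * m i) ≤ κ i i)
    (hoff : ∀ i j, i ≠ j → |κ i j| ≤ β / (2 * N) * (m i * m j)) :
    β / 2 * ∑ i, ‖c i‖ ^ 2 * m i ^ 2 ≤
      RCLike.re (∑ i, ∑ j, (starRingEnd 𝕜) (c i) * c j * (κ i j : 𝕜)) := by
  classical
  set t : ι → ℝ := fun i => ‖c i‖ * m i with ht
  have ht0 : ∀ i, 0 ≤ t i := fun i => mul_nonneg (norm_nonneg _) (hm i)
  -- Each pair gives up at most `1/(2N)` of `β * t i * t j`; by Cauchy–Schwarz the total loss is at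
  -- most half of the diagonal.
  have hterm : ∀ i j, β * ((if i = j then t i * t j else 0) - 1 / (2 * N) * (t i * t j)) ≤
      RCLike.re ((starRingEnd 𝕜) (c i) * c j * (κ i j : 𝕜)) := by
    intro i j
    by_cases h : i = j
    · subst h
      have e1 : RCLike.re ((starRingEnd 𝕜) (c i) * c i * (κ i i : 𝕜)) = ‖c i‖ ^ 2 * κ i i := by
        rw [RCLike.conj_mul]
        norm_cast
      rw [e1, if_pos rfl]
      have h1 : ‖c i‖ ^ 2 * (β * (m i * m i)) ≤ ‖c i‖ ^ 2 * κ i i :=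
        mul_le_mul_of_nonneg_left (hdiag i) (by positivity)
      have h2 : 0 ≤ β * (1 / (2 * N) * (t i * t i)) := by
        have := ht0 i
        positivity
      have h3 : β * (t i * t i) = ‖c i‖ ^ 2 * (β * (m i * m i)) := by simp only [ht]; ring
      linarith
    · rw [if_neg h]
      have h1 := (abs_le.1 (RCLike.abs_re_le_norm
        ((starRingEnd 𝕜) (c i) * c j * (κ i j : 𝕜)))).1
      have h2 : ‖(starRingEnd 𝕜) (c i) * c j * (κ i j : 𝕜)‖ = ‖c i‖ * ‖c j‖ * |κ i j| := by
        simp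
      have h3 : ‖c i‖ * ‖c j‖ * |κ i j| ≤ ‖c i‖ * ‖c j‖ * (β / (2 * N) * (m i * m j)) :=
        mul_le_mul_of_nonneg_left (hoff i j h) (by positivity)
      have h4 : ‖c i‖ * ‖c j‖ * (β / (2 * N) * (m i * m j)) =
          β * (1 / (2 * N) * (t i * t j)) := by simp only [ht]; ring
      linarith
  have hsum : β * (∑ i, t i ^ 2 - 1 / (2 * N) * (∑ i, t i) ^ 2) ≤
      RCLike.re (∑ i, ∑ j, (starRingEnd 𝕜) (c i) * c j * (κ i j : 𝕜)) := by
    have := Finset.sum_le_sum fun i (_ : i ∈ Finset.univ) =>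
      Finset.sum_le_sum fun j (_ : j ∈ Finset.univ) => hterm i j
    simp only [map_sum]
    refine le_trans (le_of_eq ?_) this
    simp only [← Finset.mul_sum, Finset.sum_sub_distrib, Finset.sum_ite_eq, Finset.mem_univ,
      if_true, pow_two, Finset.sum_mul_sum]
  have hcs : (∑ i, t i) ^ 2 ≤ N * ∑ i, t i ^ 2 := by
    refine (sq_sum_le_card_mul_sum_sq (s := Finset.univ) (f := t)).trans ?_
    exact mul_le_mul_of_nonneg_right (by simpa using hcard)
      (Finset.sum_nonneg fun _ _ => sq_nonneg _)
  have hhalf : 1 / (2 * N) * (∑ i, t i) ^ 2 ≤ 1 / 2 * ∑ i, t i ^ 2 := by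
    calc 1 / (2 * N) * (∑ i, t i) ^ 2 ≤ 1 / (2 * N) * (N * ∑ i, t i ^ 2) :=
          mul_le_mul_of_nonneg_left hcs (by positivity)
      _ = 1 / 2 * ∑ i, t i ^ 2 := by field_simp
  refine le_trans ?_ hsum
  have : ∑ i, ‖c i‖ ^ 2 * m i ^ 2 = ∑ i, t i ^ 2 := by simp only [ht, mul_pow]
  rw [this, div_mul_eq_mul_div, mul_div_assoc]
  exact mul_le_mul_of_nonneg_left (by linarith) hβ

/-! ### Mass of the kernel -/

lemma newtonianKernel_nonneg (x y : EuclideanSpace ℝ (Fin 3)) : 0 ≤ newtonianKernel x y := by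
  unfold newtonianKernel
  positivity

lemma newtonianKernel_comm (x y : EuclideanSpace ℝ (Fin 3)) :
    newtonianKernel x y = newtonianKernel y x := by
  unfold newtonianKernel
  rw [norm_sub_rev]

lemma measurable_newtonianKernel :
    Measurable fun p : EuclideanSpace ℝ (Fin 3) × EuclideanSpace ℝ (Fin 3) =>
      newtonianKernel p.1 p.2 := by
  unfold newtonianKernel
  fun_prop

/-- The total mass of the kernel over a ball of radius `a` is `O(a²)`. -/
lemma lintegral_ball_newtonianKernel_le {a : ℝ} (ha : 0 < a) (x : EuclideanSpace ℝ (Fin 3)) :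
    ∫⁻ y in Metric.ball x a, ENNReal.ofReal (newtonianKernel x y) ≤
      ENNReal.ofReal (3 * volume.real (Metric.ball (0 : EuclideanSpace ℝ (Fin 3)) 1) * a ^ 2) := by
  set f : ℝ → ℝ := (Set.Iio a).indicator fun r => 1 / (4 * Real.pi * r) with hf
  have hdim : Module.finrank ℝ (EuclideanSpace ℝ (Fin 3)) = 3 := by simp
  have hf0 : ∀ r, 0 ≤ r → 0 ≤ f r := fun r hr =>
    Set.indicator_apply_nonneg fun _ => by positivity
  -- The Jacobian `r ^ 2` absorbs the singularity, leaving `r / (4π) ≤ a` on `(0, a)`.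
  have hbound : ∀ r ∈ Set.Ioi (0 : ℝ), r ^ 2 * f r ≤ (Set.Ioo 0 a).indicator (fun _ => a) r := by
    intro r hr
    have hr : 0 < r := hr
    by_cases hra : r < a
    · rw [Set.indicator_of_mem (s := Set.Ioo 0 a) ⟨hr, hra⟩, hf,
        Set.indicator_of_mem (s := Set.Iio a) hra]
      have hpi := Real.pi_gt_three
      have : r ^ 2 * (1 / (4 * Real.pi * r)) = r / (4 * Real.pi) := by field_simp
      rw [this, div_le_iff₀ (by positivity)]
      nlinarith
    · have h1 : f r = 0 := by
        rw [hf]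
        exact Set.indicator_of_notMem (by simpa using hra) _
      rw [h1, mul_zero]
      exact Set.indicator_apply_nonneg fun _ => ha.le
  have hfm : Measurable f := by
    rw [hf]
    exact Measurable.indicator (by fun_prop) measurableSet_Iio
  have hmajor : IntegrableOn ((Set.Ioo 0 a).indicator fun _ => a) (Set.Ioi (0 : ℝ)) := by
    refine Integrable.integrableOn ?_
    rw [integrable_indicator_iff measurableSet_Ioo]
    exact integrableOn_const (by simp)
  have hint1 : IntegrableOn (fun r : ℝ => r ^ 2 * f r) (Set.Ioi 0) := by
    refine Integrable.mono' hmajor (by fun_prop) ?_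
    filter_upwards [ae_restrict_mem measurableSet_Ioi] with r hr
    rw [Real.norm_of_nonneg (mul_nonneg (sq_nonneg r) (hf0 r (le_of_lt hr)))]
    exact hbound r hr
  have hint : Integrable (fun y : EuclideanSpace ℝ (Fin 3) => f ‖y‖) := by
    rw [integrable_fun_norm_addHaar, hdim]
    simpa using hint1
  have hval : ∫ y : EuclideanSpace ℝ (Fin 3), f ‖y‖ ≤
      3 * volume.real (Metric.ball (0 : EuclideanSpace ℝ (Fin 3)) 1) * a ^ 2 := by
    rw [integral_fun_norm_addHaar, hdim]
    simp only [nsmul_eq_mul, smul_eq_mul, Nat.cast_ofNat, Nat.add_one_sub_one]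
    have : ∫ r in Set.Ioi (0 : ℝ), r ^ 2 * f r ≤ a ^ 2 := by
      refine (setIntegral_mono_on hint1 hmajor measurableSet_Ioi hbound).trans_eq ?_
      rw [setIntegral_indicator measurableSet_Ioo, Set.inter_eq_self_of_subset_right
        Set.Ioo_subset_Ioi_self]
      simp [ha.le, pow_two]
    rw [mul_assoc]
    gcongr
  calc ∫⁻ y in Metric.ball x a, ENNReal.ofReal (newtonianKernel x y)
      ≤ ∫⁻ y, ENNReal.ofReal (f ‖y - x‖) := by
        rw [← lintegral_indicator measurableSet_ball]
        refine lintegral_mono fun y => ?_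
        by_cases hy : y ∈ Metric.ball x a
        · rw [Set.indicator_of_mem hy, hf, Set.indicator_of_mem
            (show ‖y - x‖ ∈ Set.Iio a by simpa [dist_eq_norm] using hy), newtonianKernel_comm]
          rfl
        · rw [Set.indicator_of_notMem hy]
          exact bot_le
    _ = ∫⁻ y : EuclideanSpace ℝ (Fin 3), ENNReal.ofReal (f ‖y‖) :=
        lintegral_sub_right_eq_self (fun y => ENNReal.ofReal (f ‖y‖)) x
    _ = ENNReal.ofReal (∫ y : EuclideanSpace ℝ (Fin 3), f ‖y‖) :=
        (ofReal_integral_eq_lintegral_ofReal hint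
          (Filter.Eventually.of_forall fun y => hf0 _ (norm_nonneg y))).symm
    _ ≤ _ := ENNReal.ofReal_le_ofReal hval

/-- The total mass of the kernel over a set of measure `O(a³)` is `O(a²)`. -/
lemma exists_lintegral_newtonianKernel_le {c₂ : ℝ} (hc₂ : 0 < c₂) :
    ∃ C : ℝ, 0 < C ∧ ∀ (a : ℝ) (Ω : Set (EuclideanSpace ℝ (Fin 3))), 0 < a →
      volume Ω ≠ ⊤ → volume.real Ω ≤ c₂ * a ^ 3 → ∀ x,
        ∫⁻ y in Ω, ENNReal.ofReal (newtonianKernel x y) ≤ ENNReal.ofReal (C * a ^ 2) := by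
  set C₀ := 3 * volume.real (Metric.ball (0 : EuclideanSpace ℝ (Fin 3)) 1)
  have hC₀ : 0 ≤ C₀ := by positivity
  refine ⟨C₀ + c₂, by positivity, fun a Ω ha hfin hvol x => ?_⟩
  have hfar : ∀ y, y ∈ Ω \ Metric.ball x a →
      ENNReal.ofReal (newtonianKernel x y) ≤ ENNReal.ofReal a⁻¹ := by
    intro y hy
    have hy : a ≤ ‖x - y‖ := by simpa [dist_eq_norm, norm_sub_rev] using hy.2
    refine ENNReal.ofReal_le_ofReal ?_
    unfold newtonianKernel
    rw [← one_div]
    refine one_div_le_one_div_of_le ha (hy.trans ?_)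
    have := Real.pi_gt_three
    nlinarith [norm_nonneg (x - y)]
  calc ∫⁻ y in Ω, ENNReal.ofReal (newtonianKernel x y)
      ≤ ∫⁻ y in Metric.ball x a ∪ Ω \ Metric.ball x a, ENNReal.ofReal (newtonianKernel x y) :=
        lintegral_mono_set (by simp)
    _ ≤ (∫⁻ y in Metric.ball x a, ENNReal.ofReal (newtonianKernel x y)) +
          ∫⁻ y in Ω \ Metric.ball x a, ENNReal.ofReal (newtonianKernel x y) :=
        lintegral_union_le _ _ _
    _ ≤ ENNReal.ofReal (C₀ * a ^ 2) + ENNReal.ofReal a⁻¹ * volume Ω := by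
        gcongr
        · exact lintegral_ball_newtonianKernel_le ha x
        · refine (setLIntegral_mono measurable_const hfar).trans ?_
          rw [setLIntegral_const]
          gcongr
          exact Set.sdiff_subset
    _ ≤ ENNReal.ofReal (C₀ * a ^ 2) + ENNReal.ofReal a⁻¹ * ENNReal.ofReal (c₂ * a ^ 3) := by
        gcongr
        rw [← ENNReal.ofReal_toReal hfin]
        exact ENNReal.ofReal_le_ofReal hvol
    _ = ENNReal.ofReal ((C₀ + c₂) * a ^ 2) := by
        rw [← ENNReal.ofReal_mul (by positivity), ← ENNReal.ofReal_add (by positivity)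
          (by positivity)]
        congr 1
        field_simp

/-! ### Integrability and symmetry of the potential -/

section Potential

variable {A : Set (EuclideanSpace ℝ (Fin 3))} {M : ℝ}

lemma integrableOn_newtonianKernel
    (hA : ∀ x, ∫⁻ y in A, ENNReal.ofReal (newtonianKernel x y) ≤ ENNReal.ofReal M)
    (x : EuclideanSpace ℝ (Fin 3)) : IntegrableOn (newtonianKernel x) A := by
  refine ⟨(measurable_newtonianKernel.comp measurable_prodMk_left).aestronglyMeasurable, ?_⟩
  rw [hasFiniteIntegral_iff_ofReal (Filter.Eventually.of_forall (newtonianKernel_nonneg x))]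
  exact (hA x).trans_lt ENNReal.ofReal_lt_top

lemma norm_setIntegral_newtonianKernel_le (hM : 0 ≤ M)
    (hA : ∀ x, ∫⁻ y in A, ENNReal.ofReal (newtonianKernel x y) ≤ ENNReal.ofReal M)
    (x : EuclideanSpace ℝ (Fin 3)) : ‖∫ y in A, newtonianKernel x y‖ ≤ M := by
  rw [Real.norm_of_nonneg (integral_nonneg (newtonianKernel_nonneg x)),
    ← ENNReal.ofReal_le_ofReal_iff hM, ofReal_integral_eq_lintegral_ofReal
      (integrableOn_newtonianKernel hA x)
      (Filter.Eventually.of_forall (newtonianKernel_nonneg x))]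
  exact hA x

lemma stronglyMeasurable_setIntegral_newtonianKernel :
    StronglyMeasurable fun x => ∫ y in A, newtonianKernel x y :=
  measurable_newtonianKernel.stronglyMeasurable.integral_prod_right

/-- Tonelli and the symmetry of the kernel: the mass bound is applied in `x` for fixed `y`. It
serves both as the Schur test (`A = Ω`) and as the integrability behind Fubini. -/
lemma lintegral_lintegral_newtonianKernel_mul_le {𝕜 : Type*} [RCLike 𝕜]
    {Ω : Set (EuclideanSpace ℝ (Fin 3))}
    (hA : ∀ x, ∫⁻ y in A, ENNReal.ofReal (newtonianKernel x y) ≤ ENNReal.ofReal M)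
    {f : EuclideanSpace ℝ (Fin 3) → 𝕜} (hf : AEStronglyMeasurable f (volume.restrict Ω)) :
    ∫⁻ x in A, ∫⁻ y in Ω, ENNReal.ofReal (newtonianKernel x y) * ‖f y‖ₑ ≤
      ENNReal.ofReal M * ∫⁻ y in Ω, ‖f y‖ₑ := by
  rw [lintegral_lintegral_swap, ← lintegral_const_mul'' _ hf.enorm]
  · refine lintegral_mono fun y => ?_
    rw [lintegral_mul_const _ (by
      exact (measurable_newtonianKernel.comp measurable_prodMk_right).ennreal_ofReal)]
    simp_rw [fun x => newtonianKernel_comm x y]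
    gcongr
    exact hA y
  · exact measurable_newtonianKernel.ennreal_ofReal.aemeasurable.mul hf.enorm.comp_snd

/-- Symmetry of the Newtonian potential operator, tested against an indicator function. -/
lemma setIntegral_newtonianPotential {𝕜 : Type*} [RCLike 𝕜] {Ω : Set (EuclideanSpace ℝ (Fin 3))}
    (hA : ∀ x, ∫⁻ y in A, ENNReal.ofReal (newtonianKernel x y) ≤ ENNReal.ofReal M)
    {f : EuclideanSpace ℝ (Fin 3) → 𝕜} (hf : IntegrableOn f Ω) :
    ∫ x in A, newtonianPotential Ω f x = ∫ y in Ω, (∫ x in A, newtonianKernel y x) • f y := by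
  unfold newtonianPotential
  rw [integral_integral_swap]
  · refine integral_congr_ae (Filter.Eventually.of_forall fun y => ?_)
    simp only [integral_smul_const, newtonianKernel_comm y]
  · have hmeas : AEStronglyMeasurable (Function.uncurry fun x y => newtonianKernel x y • f y)
        ((volume.restrict A).prod (volume.restrict Ω)) :=
      measurable_newtonianKernel.aestronglyMeasurable.smul hf.aestronglyMeasurable.comp_snd
    refine ⟨hmeas, ?_⟩
    rw [HasFiniteIntegral, lintegral_prod _ hmeas.enorm]
    simp only [Function.uncurry, enorm_smul,
      fun x y => Real.enorm_of_nonneg (newtonianKernel_nonneg x y)]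
    exact (lintegral_lintegral_newtonianKernel_mul_le hA hf.aestronglyMeasurable).trans_lt
      (ENNReal.mul_lt_top ENNReal.ofReal_lt_top hf.hasFiniteIntegral)

end Potential

/-! ### Separated pieces of a set -/

/-- If `Ω` is covered by few small balls and has large measure, then it meets `N` far apart balls
of the covering in sets of measure at least `m`. -/
lemma exists_separated_balls {E : Type*} [NormedAddCommGroup E] [NormedSpace ℝ E]
    [FiniteDimensional ℝ E] [MeasurableSpace E] [BorelSpace E] (μ : Measure E) [μ.IsAddHaarMeasure]
    {Ω : Set E} (t : Finset E) {r D m : ℝ} (hcover : Ω ⊆ ⋃ p ∈ t, Metric.closedBall p r)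
    (hD : 0 ≤ D) (hm : 0 ≤ m) (N : ℕ)
    (hvol : N * μ.real (Metric.closedBall 0 (D + 3 * r)) + t.card * m < μ.real Ω) :
    ∃ s : Finset E, s.card = N ∧ (∀ p ∈ s, m ≤ μ.real (Ω ∩ Metric.closedBall p r)) ∧
      ∀ p ∈ s, ∀ q ∈ s, p ≠ q → D + 2 * r ≤ dist p q := by
  classical
  suffices h : ∀ k ≤ N, ∃ s : Finset E, s.card = k ∧
      (∀ p ∈ s, m ≤ μ.real (Ω ∩ Metric.closedBall p r)) ∧
      ∀ p ∈ s, ∀ q ∈ s, p ≠ q → D + 2 * r ≤ dist p q from h N le_rfl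
  intro k
  induction k with
  | zero => exact fun _ => ⟨∅, by simp⟩
  | succ k ih =>
    intro hk
    obtain ⟨s, hcard, hlarge, hsep⟩ := ih (by omega)
    -- Otherwise the `k` enlarged balls and the light balls of the covering would exhaust `Ω`,
    -- against `hvol`. The radius `D + 3 * r` concerns a point `x` within `r` of `q`; passing to the
    -- centre costs one `r`.
    have hfar : ∃ q, m ≤ μ.real (Ω ∩ Metric.closedBall q r) ∧
        ∃ x ∈ Metric.closedBall q r, ∀ p ∈ s, D + 3 * r < dist x p := by
      by_contra! hcon
      have hsub : Ω ⊆ (⋃ p ∈ s, Metric.closedBall p (D + 3 * r)) ∪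
          ⋃ p ∈ t.filter (fun p => μ.real (Ω ∩ Metric.closedBall p r) < m),
            Ω ∩ Metric.closedBall p r := by
        intro x hx
        obtain ⟨q, hq, hxq⟩ := Set.mem_iUnion₂.1 (hcover hx)
        by_cases hqm : m ≤ μ.real (Ω ∩ Metric.closedBall q r)
        · obtain ⟨p, hp, hpx⟩ := hcon q hqm x hxq
          exact Or.inl (Set.mem_iUnion₂.2 ⟨p, hp, hpx⟩)
        · exact Or.inr (Set.mem_iUnion₂.2
            ⟨q, Finset.mem_filter.2 ⟨hq, not_le.1 hqm⟩, hx, hxq⟩)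
      have h1 : μ.real (⋃ p ∈ s, Metric.closedBall p (D + 3 * r)) ≤
          k * μ.real (Metric.closedBall (0 : E) (D + 3 * r)) := by
        refine (measureReal_biUnion_finset_le _ _).trans_eq ?_
        simp [Measure.addHaar_real_closedBall_center, hcard]
      have h2 : μ.real (⋃ p ∈ t.filter (fun p => μ.real (Ω ∩ Metric.closedBall p r) < m),
            Ω ∩ Metric.closedBall p r) ≤ t.card * m := by
        refine (measureReal_biUnion_finset_le _ _).trans ?_
        refine (Finset.sum_le_card_nsmul _ _ m fun p hp => (Finset.mem_filter.1 hp).2.le).trans ?_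
        rw [nsmul_eq_mul]
        gcongr
        exact Finset.filter_subset _ _
      have h3 : (k : ℝ) * μ.real (Metric.closedBall (0 : E) (D + 3 * r)) ≤
          N * μ.real (Metric.closedBall (0 : E) (D + 3 * r)) := by
        gcongr
        omega
      have hfin : μ ((⋃ p ∈ s, Metric.closedBall p (D + 3 * r)) ∪
          ⋃ p ∈ t.filter (fun p => μ.real (Ω ∩ Metric.closedBall p r) < m),
            Ω ∩ Metric.closedBall p r) ≠ ⊤ := by
        refine Bornology.IsBounded.measure_lt_top ?_ |>.ne
        refine Bornology.IsBounded.union ?_ ?_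
        · exact (Bornology.isBounded_biUnion_finset s).2 fun p _ => Metric.isBounded_closedBall
        · exact (Bornology.isBounded_biUnion_finset _).2 fun p _ =>
            Metric.isBounded_closedBall.subset Set.inter_subset_right
      have h4 := measureReal_mono hsub hfin
      have h5 := measureReal_union_le (μ := μ) (⋃ p ∈ s, Metric.closedBall p (D + 3 * r))
        (⋃ p ∈ t.filter (fun p => μ.real (Ω ∩ Metric.closedBall p r) < m),
            Ω ∩ Metric.closedBall p r)
      linarith
    obtain ⟨q, hqm, x, hxq, hxs⟩ := hfar
    have hqs : ∀ p ∈ s, D + 2 * r < dist q p := by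
      intro p hp
      have h1 := hxs p hp
      have h2 := dist_triangle x q p
      have h3 : dist x q ≤ r := hxq
      linarith
    by_cases hq : q ∈ s
    -- A repeated centre would give `D + 2 * r < 0`, while `r ≥ 0` because the ball contains `x`.
    · have h1 := hqs q hq
      have h2 := hxs q hq
      have h3 : dist x q ≤ r := hxq
      have h4 := dist_nonneg (x := x) (y := q)
      rw [dist_self] at h1
      linarith
    · refine ⟨insert q s, by rw [Finset.card_insert_of_notMem hq, hcard], ?_, ?_⟩
      · intro p hp
        rcases Finset.mem_insert.1 hp with rfl | hp
        exacts [hqm, hlarge p hp]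
      · intro p hp p' hp' hne
        rcases Finset.mem_insert.1 hp with hpq | hps <;>
          rcases Finset.mem_insert.1 hp' with hpq' | hps'
        · exact absurd (hpq.trans hpq'.symm) hne
        · rw [hpq]
          exact (hqs p' hps').le
        · rw [hpq', dist_comm]
          exact (hqs p hps).le
        · exact hsep p hps p' hps' hne

/-- Balls of radius `R * a` can be covered by balls of radius `r * a`, their number being
independent of `a` and of the centre. -/
lemma exists_card_cover_closedBall (E : Type*) [NormedAddCommGroup E] [NormedSpace ℝ E]
    [FiniteDimensional ℝ E] (R : ℝ) {r : ℝ} (hr : 0 < r) :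
    ∃ M : ℕ, ∀ (a : ℝ) (x : E), 0 < a → ∃ t : Finset E, t.card ≤ M ∧
      Metric.closedBall x (R * a) ⊆ ⋃ p ∈ t, Metric.closedBall p (r * a) := by
  classical
  have := FiniteDimensional.proper_real E
  obtain ⟨t, -, htfin, ht⟩ := (isCompact_closedBall (0 : E) R).finite_cover_balls hr
  refine ⟨htfin.toFinset.card, fun a x ha =>
    ⟨htfin.toFinset.image fun p => x + a • p, Finset.card_image_le, fun y hy => ?_⟩⟩
  have hy' : a⁻¹ • (y - x) ∈ Metric.closedBall (0 : E) R := by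
    rw [mem_closedBall_zero_iff, norm_smul, norm_inv, Real.norm_of_nonneg ha.le,
      inv_mul_le_iff₀ ha, mul_comm, ← dist_eq_norm]
    exact hy
  obtain ⟨p, hp, hpy⟩ := Set.mem_iUnion₂.1 (ht hy')
  refine Set.mem_iUnion₂.2 ⟨x + a • p, Finset.mem_image_of_mem _ (htfin.mem_toFinset.2 hp), ?_⟩
  have hsplit : y - (x + a • p) = a • (a⁻¹ • (y - x) - p) := by
    rw [smul_sub, smul_inv_smul₀ ha.ne']
    abel
  rw [Metric.mem_ball, dist_eq_norm] at hpy
  rw [Metric.mem_closedBall, dist_eq_norm, hsplit, norm_smul, Real.norm_of_nonneg ha.le, mul_comm]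
  gcongr

/-! ### Eigenvalue bounds -/

/-- Eigenvalues of the Newtonian potential are bounded by the maximal mass of the kernel. -/
lemma eigenvalue_le_of_lintegral_newtonianKernel_le {𝕜 : Type*} [RCLike 𝕜]
    {Ω : Set (EuclideanSpace ℝ (Fin 3))} {M l : ℝ} (hM : 0 ≤ M)
    (hΩ : ∀ x, ∫⁻ y in Ω, ENNReal.ofReal (newtonianKernel x y) ≤ ENNReal.ofReal M)
    {f : EuclideanSpace ℝ (Fin 3) → 𝕜} (hf : IntegrableOn f Ω)
    (hf0 : ¬ f =ᵐ[volume.restrict Ω] 0)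
    (heig : ∀ᵐ x ∂(volume.restrict Ω), newtonianPotential Ω f x = l • f x) : l ≤ M := by
  have h1 : ‖l‖ₑ * ∫⁻ x in Ω, ‖f x‖ₑ ≤ ENNReal.ofReal M * ∫⁻ x in Ω, ‖f x‖ₑ := by
    refine le_trans ?_ (lintegral_lintegral_newtonianKernel_mul_le hΩ hf.aestronglyMeasurable)
    rw [← lintegral_const_mul'' _ hf.aestronglyMeasurable.enorm]
    refine lintegral_mono_ae (heig.mono fun x hx => ?_)
    rw [← enorm_smul, ← hx]
    refine (enorm_integral_le_lintegral_enorm _).trans_eq ?_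
    simp only [enorm_smul, fun x y => Real.enorm_of_nonneg (newtonianKernel_nonneg x y)]
  have h2 : ∫⁻ x in Ω, ‖f x‖ₑ ≠ 0 := by
    rw [Ne, lintegral_eq_zero_iff' hf.aestronglyMeasurable.enorm]
    exact fun h => hf0 (h.mono fun x hx => by simpa using hx)
  have h3 : ‖l‖ₑ ≤ ENNReal.ofReal M :=
    -- The `L¹` norm of `f` cancels, being nonzero and finite.
    (ENNReal.mul_le_mul_iff_left h2 hf.hasFiniteIntegral.ne).1 h1
  rw [← ofReal_norm, ENNReal.ofReal_le_ofReal_iff hM] at h3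
  exact (le_abs_self l).trans h3

/-- Cauchy–Schwarz against the constant function `1`. -/
lemma norm_setIntegral_le_sqrt_mul_norm {α 𝕜 : Type*} [RCLike 𝕜] [MeasurableSpace α]
    {μ : Measure α} [IsFiniteMeasure μ] (f : Lp 𝕜 2 μ) :
    ‖∫ x, f x ∂μ‖ ≤ √(μ.real Set.univ) * ‖f‖ := by
  have h := norm_inner_le_norm (𝕜 := 𝕜)
    (indicatorConstLp 2 MeasurableSet.univ (measure_ne_top μ Set.univ) (1 : 𝕜)) f
  rw [L2.inner_indicatorConstLp_one, Measure.restrict_univ,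
    norm_indicatorConstLp (by norm_num) (by norm_num)] at h
  simpa [Real.sqrt_eq_rpow] using h

lemma norm_sq_sum_smul_indicatorConstLp {α 𝕜 ι : Type*} [RCLike 𝕜] [MeasurableSpace α] [Fintype ι]
    {μ : Measure α} [IsFiniteMeasure μ] {A : ι → Set α} (hA : ∀ i, MeasurableSet (A i))
    (hdisj : Pairwise fun i j => Disjoint (A i) (A j)) (c : ι → 𝕜) :
    ‖∑ i, c i • indicatorConstLp 2 (hA i) (measure_ne_top μ (A i)) (1 : 𝕜)‖ ^ 2 =
      ∑ i, ‖c i‖ ^ 2 * μ.real (A i) := by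
  classical
  rw [@norm_sq_eq_re_inner 𝕜]
  simp only [sum_inner, inner_sum, inner_smul_left, inner_smul_right,
    L2.inner_indicatorConstLp_one_indicatorConstLp_one]
  rw [map_sum]
  refine Finset.sum_congr rfl fun i _ => ?_
  rw [Finset.sum_eq_single i]
  · rw [Set.inter_self, ← mul_assoc, RCLike.mul_conj]
    norm_cast
  · intro j _ hji
    rw [(hdisj hji).inter_eq]
    simp
  · simp

/-- Lower bound for the `n`-th eigenvalue from more than `n` small and well separated pieces. -/
lemma le_eigenvalue_of_separated {𝕜 ι : Type*} [RCLike 𝕜] [Fintype ι]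
    {Ω : Set (EuclideanSpace ℝ (Fin 3))} {M : ℝ} (hM : 0 ≤ M) (hfin : volume Ω ≠ ⊤)
    (hΩ : ∀ x, ∫⁻ y in Ω, ENNReal.ofReal (newtonianKernel x y) ≤ ENNReal.ofReal M)
    {lam : ℕ → ℝ} {e : HilbertBasis ℕ 𝕜 (Lp 𝕜 2 (volume.restrict Ω))}
    (he : IsNewtonianEigensystem Ω lam e) {n : ℕ} (hn : n < Fintype.card ι)
    {A : ι → Set (EuclideanSpace ℝ (Fin 3))} (hA : ∀ i, MeasurableSet (A i))
    (hAΩ : ∀ i, A i ⊆ Ω) {δ m : ℝ} (hδ : 0 < δ) (hm : 0 < m)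
    (hmA : ∀ i, m ≤ volume.real (A i))
    (hdiam : ∀ i, ∀ x ∈ A i, ∀ y ∈ A i, ‖x - y‖ ≤ δ)
    (hsep : ∀ i j, i ≠ j → ∀ x ∈ A i, ∀ y ∈ A j, 2 * Fintype.card ι * δ ≤ ‖x - y‖) :
    m / (8 * Real.pi * δ) ≤ lam n := by
  classical
  have hfinM : IsFiniteMeasure (volume.restrict Ω) := ⟨by simpa using hfin.lt_top⟩
  have hAfin : ∀ i, volume (A i) ≠ ⊤ := fun i => measure_ne_top_of_subset (hAΩ i) hfin
  have hcard : 0 < (Fintype.card ι : ℝ) := by exact_mod_cast (Nat.zero_le n).trans_lt hn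
  have hkA : ∀ i x, ∫⁻ y in A i, ENNReal.ofReal (newtonianKernel x y) ≤ ENNReal.ofReal M :=
    fun i x => (lintegral_mono_set (hAΩ i)).trans (hΩ x)
  -- `U i` is the potential of the indicator of `A i`. Its class `u i` plays the role of `N_Ω (χ
  -- i)`, so the operator on `L²` need not be constructed.
  set U : ι → EuclideanSpace ℝ (Fin 3) → ℝ := fun i x => ∫ y in A i, newtonianKernel x y with hU
  have hUm : ∀ i, StronglyMeasurable (U i) := fun i =>
    stronglyMeasurable_setIntegral_newtonianKernel
  have hUb : ∀ i x, ‖U i x‖ ≤ M := fun i => norm_setIntegral_newtonianKernel_le hM (hkA i)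
  have hUint : ∀ i j, IntegrableOn (U i) (A j) := fun i j =>
    Measure.integrableOn_of_bounded (hAfin j) (hUm i).aestronglyMeasurable
      (Filter.Eventually.of_forall (hUb i))
  have hULp : ∀ i, MemLp (fun x => (U i x : 𝕜)) 2 (volume.restrict Ω) := fun i =>
    MemLp.of_bound (RCLike.continuous_ofReal.comp_aestronglyMeasurable
      (hUm i).aestronglyMeasurable) M (Filter.Eventually.of_forall fun x => by
        rw [RCLike.norm_ofReal]; exact hUb i x)
  have hmu : ∀ i, volume.restrict Ω (A i) ≠ ⊤ := fun i => measure_ne_top _ _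
  set χ : ι → Lp 𝕜 2 (volume.restrict Ω) := fun i => indicatorConstLp 2 (hA i) (hmu i) 1 with hχ
  set u : ι → Lp 𝕜 2 (volume.restrict Ω) := fun i => (hULp i).toLp with hu
  have hres : ∀ i, (volume.restrict Ω).restrict (A i) = volume.restrict (A i) := fun i =>
    Measure.restrict_restrict_of_subset (hAΩ i)
  have hreal : ∀ i, (volume.restrict Ω).real (A i) = volume.real (A i) := fun i => by
    rw [measureReal_restrict_apply (hA i), Set.inter_eq_self_of_subset_left (hAΩ i)]
  -- symmetry on the eigenfunctions
  have hsymm : ∀ i k, inner 𝕜 (u i) (e k) = lam k • inner 𝕜 (χ i) (e k) := by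
    intro i k
    have hek : IntegrableOn (fun y => e k y) Ω := (Lp.memLp (e k)).integrable (by norm_num)
    have h1 : inner 𝕜 (u i) (e k) = ∫ x in Ω, U i x • e k x := by
      rw [L2.inner_def]
      refine integral_congr_ae ((hULp i).coeFn_toLp.mono fun x hx => ?_)
      simp only [hu, hx]
      rw [RCLike.inner_apply, RCLike.conj_ofReal, RCLike.real_smul_eq_coe_mul, mul_comm]
    have h2 := ae_restrict_of_ae_restrict_of_subset (hAΩ i) (he.eigen k)
    rw [h1, L2.inner_indicatorConstLp_one, hres, ← integral_smul, ← integral_congr_ae h2,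
      setIntegral_newtonianPotential (hkA i) hek]
  -- the entries of the Gram matrix
  have hgram : ∀ i j, inner 𝕜 (χ i) (u j) = ((∫ x in A i, U j x : ℝ) : 𝕜) := by
    intro i j
    rw [L2.inner_indicatorConstLp_one, hres, ← integral_ofReal]
    exact integral_congr_ae (ae_restrict_of_ae_restrict_of_subset (hAΩ i) (hULp j).coeFn_toLp)
  have hpi := Real.pi_pos
  have hUdiag : ∀ i, ∀ x ∈ A i, 1 / (4 * Real.pi * δ) * volume.real (A i) ≤ U i x := by
    intro i x hx
    have h1 : ∫ _ in A i, 1 / (4 * Real.pi * δ) = 1 / (4 * Real.pi * δ) * volume.real (A i) := by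
      rw [setIntegral_const, smul_eq_mul, mul_comm]
    rw [← h1]
    refine setIntegral_mono_on_ae (integrableOn_const (hAfin i))
      (integrableOn_newtonianKernel (hkA i) x) (hA i) ?_
    -- At `y = x` the kernel is `0` by division by zero and the bound fails; this null set is
    -- discarded.
    filter_upwards [Measure.ae_ne volume x] with y hyx hy
    unfold newtonianKernel
    have hpos : 0 < ‖x - y‖ := norm_pos_iff.2 (sub_ne_zero.2 hyx.symm)
    have := hdiam i x hx y hy
    gcongr
  have hUoff : ∀ i j, i ≠ j → ∀ x ∈ A i,
      U j x ≤ 1 / (4 * Real.pi * δ) / (2 * Fintype.card ι) * volume.real (A j) := by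
    intro i j hij x hx
    have h1 : ∫ _ in A j, 1 / (4 * Real.pi * δ) / (2 * Fintype.card ι) =
        1 / (4 * Real.pi * δ) / (2 * Fintype.card ι) * volume.real (A j) := by
      rw [setIntegral_const, smul_eq_mul, mul_comm]
    rw [← h1]
    refine setIntegral_mono_on (integrableOn_newtonianKernel (hkA j) x)
      (integrableOn_const (hAfin j)) (hA j) fun y hy => ?_
    unfold newtonianKernel
    rw [div_div]
    have := hsep i j hij x hx y hy
    refine one_div_le_one_div_of_le (by positivity) ?_
    calc 4 * Real.pi * δ * (2 * Fintype.card ι) = 4 * Real.pi * (2 * Fintype.card ι * δ) := by ring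
      _ ≤ 4 * Real.pi * ‖x - y‖ := by gcongr
  have hdiag : ∀ i, 1 / (4 * Real.pi * δ) * (volume.real (A i) * volume.real (A i)) ≤
      ∫ x in A i, U i x := by
    intro i
    have h1 := setIntegral_mono_on (integrableOn_const (hAfin i)) (hUint i i) (hA i) (hUdiag i)
    rw [setIntegral_const, smul_eq_mul] at h1
    linarith
  have hoff : ∀ i j, i ≠ j → |∫ x in A i, U j x| ≤ 1 / (4 * Real.pi * δ) / (2 * Fintype.card ι) *
      (volume.real (A i) * volume.real (A j)) := by
    intro i j hij
    rw [abs_of_nonneg (integral_nonneg fun x => integral_nonneg (newtonianKernel_nonneg x))]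
    have h1 := setIntegral_mono_on (hUint j i) (integrableOn_const (hAfin i)) (hA i) (hUoff i j hij)
    rw [setIntegral_const, smul_eq_mul] at h1
    linarith
  -- a test function orthogonal to the first `n` eigenfunctions
  obtain ⟨c, hc, hc0⟩ : ∃ c : ι → 𝕜, (∀ k : Fin n, inner 𝕜 (e k) (∑ i, c i • χ i) = 0) ∧ c ≠ 0 := by
    let T : (ι → 𝕜) →ₗ[𝕜] (Fin n → 𝕜) := LinearMap.pi fun k =>
      (innerSL 𝕜 (e k)).toLinearMap ∘ₗ Fintype.linearCombination 𝕜 χ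
    have hT : LinearMap.ker T ≠ ⊥ := LinearMap.ker_ne_bot_of_finrank_lt (by simpa using hn)
    obtain ⟨c, hc, hc0⟩ := Submodule.exists_mem_ne_zero_of_ne_bot hT
    exact ⟨c, fun k => congrFun (LinearMap.mem_ker.1 hc) k, hc0⟩
  set F := ∑ i, c i • χ i with hF
  set P := ∑ i, c i • u i with hP
  have hupper : RCLike.re (inner 𝕜 P F) ≤ lam n * ‖F‖ ^ 2 := by
    refine e.re_inner_le_of_orthogonal he.antitone n F P (fun k => ?_) fun k hk => ?_
    · simp only [hF, hP, sum_inner, inner_smul_left, hsymm, Finset.smul_sum, mul_smul_comm]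
    · rw [← inner_conj_symm, hc ⟨k, hk⟩, map_zero]
  have hlower := re_sum_sum_ge_of_diagonal_dominant c (fun i j => ∫ x in A i, U j x)
    (fun i => volume.real (A i)) (fun i => measureReal_nonneg)
    (by positivity : 0 ≤ 1 / (4 * Real.pi * δ)) hcard le_rfl hdiag hoff
  have hPF : RCLike.re (inner 𝕜 P F) = RCLike.re (∑ i, ∑ j, (starRingEnd 𝕜) (c i) * c j *
      ((∫ x in A i, U j x : ℝ) : 𝕜)) := by
    rw [inner_re_symm, hF, hP]
    simp only [sum_inner, inner_sum, inner_smul_left, inner_smul_right, hgram]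
    rw [Finset.sum_comm]
    congr 1
    refine Finset.sum_congr rfl fun i _ => ?_
    rw [Finset.mul_sum]
    refine Finset.sum_congr rfl fun j _ => ?_
    ring
  have hnorm : ‖F‖ ^ 2 = ∑ i, ‖c i‖ ^ 2 * volume.real (A i) := by
    have hdisj : Pairwise fun i j => Disjoint (A i) (A j) := by
      refine fun i j hij => Set.disjoint_left.2 fun x hxi hxj => ?_
      have h1 := hsep i j hij x hxi x hxj
      rw [sub_self, norm_zero] at h1
      have : 0 < 2 * Fintype.card ι * δ := by positivity
      linarith
    rw [hF, norm_sq_sum_smul_indicatorConstLp hA hdisj]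
    simp only [hreal]
  have hFpos : 0 < ‖F‖ ^ 2 := by
    obtain ⟨i, hi⟩ := Function.ne_iff.1 hc0
    rw [hnorm]
    refine Finset.sum_pos' (fun j _ => by positivity) ⟨i, Finset.mem_univ i, ?_⟩
    exact mul_pos (pow_pos (norm_pos_iff.2 hi) 2) (hm.trans_le (hmA i))
  -- One of the two factors `volume.real (A i)` is bounded below by `m`, the other rebuilds `‖F‖ ^
  -- 2`.
  have hcmp : m * ‖F‖ ^ 2 ≤ ∑ i, ‖c i‖ ^ 2 * volume.real (A i) ^ 2 := by
    rw [hnorm, Finset.mul_sum]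
    refine Finset.sum_le_sum fun i _ => ?_
    have := mul_le_mul_of_nonneg_right (hmA i)
      (by positivity : 0 ≤ ‖c i‖ ^ 2 * volume.real (A i))
    linarith
  refine le_of_mul_le_mul_right ?_ hFpos
  refine le_trans ?_ hupper
  rw [hPF]
  refine le_trans ?_ hlower
  calc m / (8 * Real.pi * δ) * ‖F‖ ^ 2 = 1 / (4 * Real.pi * δ) / 2 * (m * ‖F‖ ^ 2) := by
        field_simp
        ring
    _ ≤ _ := by gcongr

/-! ### The two-sided estimates -/

theorem proposition1 {𝕜 : Type*} [RCLike 𝕜] :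
    (∀ c₂ : ℝ, 0 < c₂ → ∃ C : ℝ, 0 < C ∧
      ∀ (a : ℝ) (Ω : Set (EuclideanSpace ℝ (Fin 3))), 0 < a →
        MeasurableSet Ω → Bornology.IsBounded Ω → volume.real Ω ≤ c₂ * a ^ 3 →
        ∀ (lam : ℕ → ℝ) (e : HilbertBasis ℕ 𝕜 (Lp 𝕜 2 (volume.restrict Ω))),
          IsNewtonianEigensystem Ω lam e →
          ∀ n : ℕ, lam n ≤ C * a ^ 2 ∧ ‖∫ x in Ω, e n x‖ ≤ C * a ^ (3 / 2 : ℝ)) ∧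
    (∀ c₁ R : ℝ, 0 < c₁ → 0 < R → ∀ n : ℕ, ∃ c : ℝ, 0 < c ∧
      ∀ (a : ℝ) (Ω : Set (EuclideanSpace ℝ (Fin 3))), 0 < a →
        MeasurableSet Ω → Bornology.IsBounded Ω → c₁ * a ^ 3 ≤ volume.real Ω →
        Metric.diam Ω ≤ R * a →
        ∀ (lam : ℕ → ℝ) (e : HilbertBasis ℕ 𝕜 (Lp 𝕜 2 (volume.restrict Ω))),
          IsNewtonianEigensystem Ω lam e → c * a ^ 2 ≤ lam n) := by
  constructor
  · intro c₂ hc₂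
    obtain ⟨C, hC, hker⟩ := exists_lintegral_newtonianKernel_le hc₂
    refine ⟨max C (√c₂), lt_max_of_lt_left hC, fun a Ω ha _ hb hvol lam e he n => ?_⟩
    have hfin : volume Ω ≠ ⊤ := hb.measure_lt_top.ne
    have : IsFiniteMeasure (volume.restrict Ω) := ⟨by simpa using hfin.lt_top⟩
    have hnorm : ‖e n‖ = 1 := e.orthonormal.1 n
    constructor
    · have h1 : lam n ≤ C * a ^ 2 :=
        eigenvalue_le_of_lintegral_newtonianKernel_le (by positivity) (hker a Ω ha hfin hvol)
          ((Lp.memLp (e n)).integrable (by norm_num))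
          (fun h => by
            rw [(Lp.eq_zero_iff_ae_eq_zero).2 h, norm_zero] at hnorm
            exact zero_ne_one hnorm) (he.eigen n)
      exact h1.trans (by gcongr; exact le_max_left _ _)
    · refine (norm_setIntegral_le_sqrt_mul_norm (e n)).trans ?_
      rw [hnorm, mul_one, measureReal_restrict_apply_univ]
      have h1 : √(a ^ 3) = a ^ (3 / 2 : ℝ) := by
        rw [Real.sqrt_eq_rpow, ← Real.rpow_natCast, ← Real.rpow_mul ha.le]
        norm_num
      calc √(volume.real Ω) ≤ √(c₂ * a ^ 3) := Real.sqrt_le_sqrt hvol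
        _ = √c₂ * a ^ (3 / 2 : ℝ) := by rw [Real.sqrt_mul hc₂.le, h1]
        _ ≤ _ := by gcongr; exact le_max_right _ _
  · intro c₁ R hc₁ hR n
    set N : ℕ := n + 1 with hN
    set V : ℝ := volume.real (Metric.ball (0 : EuclideanSpace ℝ (Fin 3)) 1)
    have hV : 0 ≤ V := measureReal_nonneg
    -- `K * r ^ 3 * a ^ 3` is the volume of `N` balls of radius `D + 3 * (r * a)`, where `D = 4 * N
    -- * (r * a)`.
    set K : ℝ := N * ((4 * N + 3) ^ 3 * V) with hK
    have hK0 : 0 ≤ K := by positivity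
    -- The cap `1` gives `r ^ 3 ≤ r`, which avoids a cube root; `K + 1` keeps the denominator
    -- positive.
    set r : ℝ := min 1 (c₁ / (4 * (K + 1))) with hr
    have hr0 : 0 < r := lt_min one_pos (by positivity)
    have hKr : K * r ^ 3 ≤ c₁ / 4 := by
      have h1 : r ^ 3 ≤ r := pow_le_of_le_one hr0.le (min_le_left _ _) (by norm_num)
      calc K * r ^ 3 ≤ (K + 1) * (c₁ / (4 * (K + 1))) := by
            gcongr
            · linarith
            · exact h1.trans (min_le_right _ _)
        _ = c₁ / 4 := by field_simp
    obtain ⟨T, hT⟩ := exists_card_cover_closedBall (EuclideanSpace ℝ (Fin 3)) R hr0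
    -- Light balls then cover at most `c₁ / 4 * a ^ 3`; with the enlarged balls this is at most half
    -- of the volume guaranteed for `Ω`.
    set m : ℝ := c₁ / (4 * (T + 1)) with hm
    have hm0 : 0 < m := by positivity
    have hTm : T * m ≤ c₁ / 4 := by
      calc T * m ≤ (T + 1) * m := by gcongr; linarith
        _ = c₁ / 4 := by rw [hm]; field_simp
    refine ⟨m / (8 * Real.pi * (2 * r)), by positivity,
      fun a Ω ha hmeas hb hvol hdiam lam e he => ?_⟩
    have hfin : volume Ω ≠ ⊤ := hb.measure_lt_top.ne
    have hpos : 0 < volume.real Ω := lt_of_lt_of_le (by positivity) hvol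
    obtain ⟨x₀, hx₀⟩ : Ω.Nonempty := by
      rw [Set.nonempty_iff_ne_empty]
      rintro rfl
      simp at hpos
    obtain ⟨t, htcard, htcover⟩ := hT a x₀ ha
    have hcover : Ω ⊆ ⋃ p ∈ t, Metric.closedBall p (r * a) := fun x hx =>
      htcover ((Metric.dist_le_diam_of_mem hb hx hx₀).trans hdiam)
    obtain ⟨s, hscard, hslarge, hssep⟩ := exists_separated_balls volume t
      -- `D = 2 * N * δ` for the diameter bound `δ = 2 * (r * a)` of the pieces.
      (D := 4 * N * (r * a)) (m := m * a ^ 3)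
      hcover (by positivity) (by positivity) N (by
        rw [Measure.addHaar_real_closedBall _ _ (by positivity), finrank_euclideanSpace_fin]
        have h1 : (t.card : ℝ) * (m * a ^ 3) ≤ T * (m * a ^ 3) := by gcongr
        have h2 := mul_le_mul_of_nonneg_right hKr (by positivity : 0 ≤ a ^ 3)
        have h3 := mul_le_mul_of_nonneg_right hTm (by positivity : 0 ≤ a ^ 3)
        have h4 : N * ((4 * N * (r * a) + 3 * (r * a)) ^ 3 * V) = K * r ^ 3 * a ^ 3 := by
          rw [hK]
          ring
        have h5 : 0 < c₁ * a ^ 3 := by positivity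
        linarith)
    -- This `C` may depend on `Ω`: only finiteness of the kernel mass is needed, and its value does
    -- not enter the lower bound.
    obtain ⟨C, hC, hker⟩ := exists_lintegral_newtonianKernel_le
      (c₂ := volume.real Ω / a ^ 3) (by positivity)
    have key := le_eigenvalue_of_separated (ι := s) (n := n)
      (A := fun p => Ω ∩ Metric.closedBall p.1 (r * a))
      (δ := 2 * (r * a)) (m := m * a ^ 3) (M := C * a ^ 2) (by positivity) hfin
      (hker a Ω ha hfin (by field_simp; rfl)) he (by simp [hscard, hN])
      (fun p => hmeas.inter Metric.isClosed_closedBall.measurableSet)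
      (fun p => Set.inter_subset_left) (by positivity) (by positivity)
      (fun p => hslarge p.1 p.2) ?_ ?_
    · refine le_of_eq_of_le ?_ key
      field_simp
    · rintro p x ⟨-, hx⟩ y ⟨-, hy⟩
      rw [← dist_eq_norm]
      have := dist_triangle_right x y p.1
      rw [Metric.mem_closedBall] at hx hy
      linarith
    · rintro p q hpq x ⟨-, hx⟩ y ⟨-, hy⟩
      rw [← dist_eq_norm]
      have h1 := hssep p.1 p.2 q.1 q.2 (fun h => hpq (Subtype.ext h))
      have h2 := dist_triangle4 p.1 x y q.1
      rw [Metric.mem_closedBall] at hx hy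
      rw [dist_comm p.1 x] at h2
      simp only [Fintype.card_coe, hscard]
      have : (0 : ℝ) ≤ N * (r * a) := by positivity
      linarith
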